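/- Let $X$ be a Hausdorff locally convex real topological vector space, let $K\subseteq X$ be nonempty, convex and compact, and let $D\subseteq K$ be self segment-dense in $K$; that is, $D$ is dense in $K$ and, for all $u,v\in D$, the set $[u,v]\cap D$ is dense in the closed line segment $[u,v]$. Let $\varphi:K\times K\to\mathbb{R}$ satisfy: (i) for every $y\in D$, the function $x\mapsto\varphi(x,y)$ is lower semicontinuous on $K$; (ii) for every $x\in K$, the function $y\mapsto\varphi(x,y)$, defined on $K$, is lower semicontinuous at every point of $K\setminus D$; (iii) for every $x\in D$, the function $y\mapsto\varphi(x,y)$ is concave on $D$, in the sense that $\sum_{i=1}^n\lambda_i\varphi(x,y_i)\le\varphi\bigl(x,\sum_{i=1}^n\lambda_iy_i\bigr)$ whenever $n\ge 1$, $y_1,\dots,y_n\in D$, $\lambda_1,\dots,\lambda_n\ge 0$, $\sum_{i=1}^n\lambda_i=1$ and $\sum_{i=1}^n\lambda_iy_i\in D$ ($D$ itself need not be convex); (iv) $\varphi(x,x)\le 0$ for every $x\in D$. Then there exists $x_0\in K$ such that $\varphi(x_0,y)\le 0$ for all $y\in K$. -/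

import Mathlib

/-- `U` is self segment-dense in the (convex) set `V`: `U` is a subset of `V`, `U` is dense in `V`,
and for all `x, y ∈ U` the set `[x, y] ∩ U` is dense in the closed segment `[x, y]`. Here `P` is
dense in `Q` when `Q` is contained in the closure of `P`. -/
def IsSelfSegmentDense {X : Type*} [AddCommGroup X] [Module ℝ X] [TopologicalSpace X]
    (U V : Set X) : Prop :=
  U ⊆ V ∧ V ⊆ closure U ∧
    ∀ x ∈ U, ∀ y ∈ U, segment ℝ x y ⊆ closure (segment ℝ x y ∩ U)

/-- Concavity of `f` on a set `D` that need not be convex: the concavity inequality is required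
for every finite convex combination of points of `D` that itself lies in `D`. -/
def IsConcaveOnSubset {X : Type*} [AddCommGroup X] [Module ℝ X]
    (D : Set X) (f : X → ℝ) : Prop :=
  ∀ (n : ℕ) (x : Fin n → X) (w : Fin n → ℝ),
    (∀ i, x i ∈ D) → (∀ i, 0 ≤ w i) → ∑ i, w i = 1 → ∑ i, w i • x i ∈ D →
      ∑ i, w i * f (x i) ≤ f (∑ i, w i • x i)

/-! For `y ∈ D` the set `F y = {x ∈ K | φ x y ≤ 0}` is closed in the compact `K`, so a point common
to all of them exists once finitely many always meet. Given `y i ∈ D`, pull the `F (y i)` back to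
the simplex along `l ↦ ∑ i, l i • y i` and apply KKM (`exists_mem_stdSimplex_forall_mem_of_kkm`).
Its covering condition is first checked at points `z ∈ D` of a polytope spanned by some of the `y
i`: were every `φ z (y i)` positive there, concavity would give `φ z z > 0`. Self segment-density
makes such `z` dense in the polytope (`IsSelfSegmentDense.convexHull_subset_closure`), and a finite
union of closed sets passes to the closure. Values at `y ∈ K \ D` follow from lower semicontinuity
in `y` and density of `D`.

KKM is obtained from Scarf's combinatorial lemma, a parity argument in the manner of Sperner,
applied to ever finer grids. -/

/-! ### Scarf's combinatorial lemma. -/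

namespace Scarf

variable {E I L : Type*} [LinearOrder L]

/-- `S` is dominant for the family of preorders on `E` given by `r`: every element of `E` is a
lower bound of `S` for at least one of them. -/
def Dominant (r : I → E → L) (S : Finset E) : Prop :=
  ∀ y, ∃ i, ∀ x ∈ S, r i y ≤ r i x

theorem Dominant.mono {r : I → E → L} {S T : Finset E} (hS : Dominant r S) (h : T ⊆ S) :
    Dominant r T := fun y => (hS y).imp fun _ hi x hx => hi x (h hx)

/-- `x` is the `k`-largest element that exceeds `m i` in the `i`-th order for all `i ≠ k`. -/
def IsReplacement (r : I → E → L) (m : I → E) (k : I) (x : E) : Prop :=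
  (∀ i, i ≠ k → r i (m i) < r i x) ∧ ∀ y, (∀ i, i ≠ k → r i (m i) < r i y) → r k y ≤ r k x

theorem IsReplacement.unique {r : I → E → L} (hr : ∀ i, Function.Injective (r i)) {m : I → E}
    {k : I} {x y : E} (hx : IsReplacement r m k x) (hy : IsReplacement r m k y) : x = y :=
  hr k (le_antisymm (hy.2 x hx.1) (hx.2 y hy.1))

theorem exists_isReplacement [Finite E] {r : I → E → L} {m : I → E} {k : I} {y : E}
    (hy : ∀ i, i ≠ k → r i (m i) < r i y) : ∃ x, IsReplacement r m k x := by
  obtain ⟨x, hx, hmax⟩ := Set.exists_max_image {z | ∀ i, i ≠ k → r i (m i) < r i z} (r k)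
    (Set.toFinite _) ⟨y, hy⟩
  exact ⟨x, hx, hmax⟩

theorem exists_minimizers (r : I → E → L) {S : Finset E} (hS : S.Nonempty) :
    ∃ m : I → E, (∀ i, m i ∈ S) ∧ ∀ i, ∀ x ∈ S, r i (m i) ≤ r i x := by
  choose m hm using fun i => S.exists_min_image (r i) hS
  exact ⟨m, fun i => (hm i).1, fun i => (hm i).2⟩

theorem Dominant.exists_minimizer_eq {r : I → E → L} (hr : ∀ i, Function.Injective (r i))
    {S : Finset E} (hS : Dominant r S) {m : I → E} (hmS : ∀ i, m i ∈ S)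
    (hm : ∀ i, ∀ x ∈ S, r i (m i) ≤ r i x) {y : E} (hy : y ∈ S) : ∃ i, m i = y := by
  obtain ⟨i, hi⟩ := hS y
  exact ⟨i, hr i (le_antisymm (hm i y hy) (hi _ (hmS i)))⟩

variable [DecidableEq E]

/-- By `hk` the index `k` is not needed to realise `τ` as minimizers. An element above every `m i`,
`i ≠ k`, lies below `x` in order `k`, and dominance of `τ` at `x` can only hold in order `k`; any
other element is below some `m i`, which is itself below `x`. -/
theorem dominant_insert_of_isReplacement {r : I → E → L} {τ : Finset E} (hτ : Dominant r τ)
    {m : I → E} (hmτ : ∀ i, m i ∈ τ) (hm : ∀ i, ∀ x ∈ τ, r i (m i) ≤ r i x) {k : I}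
    (hk : ∀ y ∈ τ, ∃ i, i ≠ k ∧ m i = y) {x : E} (hx : IsReplacement r m k x) :
    x ∉ τ ∧ Dominant r (insert x τ) := by
  refine ⟨fun hxτ => ?_, fun y => ?_⟩
  · obtain ⟨i, hik, rfl⟩ := hk x hxτ
    exact lt_irrefl _ (hx.1 i hik)
  · by_cases hy : ∀ i, i ≠ k → r i (m i) < r i y
    · refine ⟨k, fun z hz => ?_⟩
      rcases Finset.mem_insert.1 hz with rfl | hz
      · exact hx.2 y hy
      · refine (hx.2 y hy).trans ?_
        obtain ⟨i, hi⟩ := hτ x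
        have : i = k := by
          by_contra hik
          exact absurd (hi _ (hmτ i)) (not_le.2 (hx.1 i hik))
        exact this ▸ hi z hz
    · push Not at hy
      obtain ⟨i, hik, hi⟩ := hy
      refine ⟨i, fun z hz => hi.trans ?_⟩
      rcases Finset.mem_insert.1 hz with rfl | hz
      · exact (hx.1 i hik).le
      · exact hm i z hz

/-- A dominant set with one element less than the number of orders has a repeated minimizer, and
its dominant extensions by one element are the replacements at the two repeated indices. -/
theorem Dominant.exists_collision [Fintype I] {r : I → E → L}
    (hr : ∀ i, Function.Injective (r i)) {τ : Finset E} (hτ : Dominant r τ) (hne : τ.Nonempty)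
    (hcard : τ.card + 1 = Fintype.card I) :
    ∃ (m : I → E) (a b : I), (∀ i, m i ∈ τ) ∧ (∀ i, ∀ x ∈ τ, r i (m i) ≤ r i x) ∧ a ≠ b ∧
      m a = m b ∧
      ∀ x, (x ∉ τ ∧ Dominant r (insert x τ)) ↔ IsReplacement r m a x ∨ IsReplacement r m b x := by
  obtain ⟨m, hmτ, hm⟩ := exists_minimizers r hne
  have hsurj : ∀ y ∈ τ, ∃ i, m i = y := fun y hy => hτ.exists_minimizer_eq hr hmτ hm hy
  obtain ⟨a, -, b, -, hab, hmab⟩ := Finset.exists_ne_map_eq_of_card_lt_of_maps_to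
    (s := Finset.univ) (t := τ) (f := m) (by rw [Finset.card_univ]; omega) (fun i _ => hmτ i)
  refine ⟨m, a, b, hmτ, hm, hab, hmab, fun x => ⟨?_, ?_⟩⟩
  · rintro ⟨hxτ, hdom⟩
    -- The extension has as many elements as there are orders, so its minimizers `m'` form a
    -- bijection. Away from the one index `k` with `m' k = x` they agree with `m`, whence `m a = m
    -- b` forces `k` to be `a` or `b`.
    obtain ⟨m', hm'S, hm'⟩ := exists_minimizers r (Finset.insert_nonempty x τ)
    have hsurj' : Function.Surjective
        (fun i => (⟨m' i, hm'S i⟩ : {y // y ∈ insert x τ})) := fun ⟨y, hy⟩ => by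
      obtain ⟨i, hi⟩ := hdom.exists_minimizer_eq hr hm'S hm' hy
      exact ⟨i, Subtype.ext hi⟩
    have hinj : Function.Injective m' := by
      have := ((Fintype.bijective_iff_surjective_and_card _).2 ⟨hsurj', by
        rw [Fintype.card_coe, Finset.card_insert_of_notMem hxτ, hcard]⟩).1
      exact fun i j hij => this (Subtype.ext hij)
    obtain ⟨k, hk⟩ := hdom.exists_minimizer_eq hr hm'S hm' (Finset.mem_insert_self x τ)
    have heq : ∀ i, i ≠ k → m' i = m i := fun i hik => by
      have h1 : m' i ∈ τ := (Finset.mem_insert.1 (hm'S i)).resolve_left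
        fun h => hik (hinj (h.trans hk.symm))
      exact hr i (le_antisymm (hm' i _ (Finset.mem_insert_of_mem (hmτ i))) (hm i _ h1))
    have hrep : IsReplacement r m k x := by
      have hlt : ∀ i, i ≠ k → r i (m i) < r i x := fun i hik =>
        lt_of_le_of_ne (heq i hik ▸ hm' i x (Finset.mem_insert_self x τ))
          fun h => hxτ (hr i h ▸ hmτ i)
      refine ⟨hlt, fun y hy => ?_⟩
      obtain ⟨i, hi⟩ := hdom y
      have : i = k := by
        by_contra hik
        exact absurd (hi _ (Finset.mem_insert_of_mem (hmτ i))) (not_le.2 (hy i hik))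
      exact this ▸ hi x (Finset.mem_insert_self x τ)
    by_cases hka : k = a
    · exact Or.inl (hka ▸ hrep)
    by_cases hkb : k = b
    · exact Or.inr (hkb ▸ hrep)
    · exact absurd (hinj ((heq a (Ne.symm hka)).trans
        (hmab.trans (heq b (Ne.symm hkb)).symm))) hab
  · have key : ∀ k l : I, k ≠ l → m k = m l → ∀ y ∈ τ, ∃ i, i ≠ k ∧ m i = y := by
      intro k l hkl hm' y hy
      obtain ⟨i, hi⟩ := hsurj y hy
      by_cases hik : i = k
      · exact ⟨l, hkl.symm, by rw [← hm', ← hik, hi]⟩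
      · exact ⟨i, hik, hi⟩
    rintro (hx | hx)
    · exact dominant_insert_of_isReplacement hτ hmτ hm (key a b hab hmab) hx
    · exact dominant_insert_of_isReplacement hτ hmτ hm (key b a hab.symm hmab.symm) hx

/-- `s i` are slack elements: `s i` is the least element for the `i`-th order, and every
non-slack element lies below `s j` for the `i`-th order whenever `j ≠ i`. -/
structure IsSlack (r : I → E → L) (s : I → E) : Prop where
  lt_of_ne : ∀ i y, y ≠ s i → r i (s i) < r i y
  lt_slack : ∀ i j y, j ≠ i → y ∉ Set.range s → r i y < r i (s j)

/-- Interior facets lie in two rooms. Because of the non-slack `t`, a slack element can be minimal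
in `τ` only for its own order; hence `s k` is a candidate at each repeated index `k`, and both
replacements exist. They differ, since a common one would lie below `τ` in no order. -/
theorem IsSlack.card_extensions_of_mem [Fintype E] [Fintype I] {r : I → E → L}
    (hr : ∀ i, Function.Injective (r i)) {s : I → E} (hs : IsSlack r s)
    {τ : Finset E} (hτ : Dominant r τ) (hcard : τ.card + 1 = Fintype.card I) {t : E}
    (htτ : t ∈ τ) (hts : t ∉ Set.range s) :
    ∃ x y, x ≠ y ∧ ∀ z, (z ∉ τ ∧ Dominant r (insert z τ)) ↔ z = x ∨ z = y := by
  obtain ⟨m, a, b, hmτ, hm, hab, hmab, hiff⟩ := hτ.exists_collision hr ⟨t, htτ⟩ hcard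
  have hslack : ∀ i j, m i = s j → i = j := fun i j hij => by
    by_contra h
    exact absurd (hij ▸ hm i t htτ) (not_le.2 (hs.lt_slack i j t (Ne.symm h) hts))
  have key : ∀ k l : I, k ≠ l → m k = m l → ∃ x, IsReplacement r m k x := by
    intro k l hkl hm'
    refine exists_isReplacement (y := s k) fun i hik => ?_
    by_cases h : m i ∈ Set.range s
    · obtain ⟨j, hj⟩ := h
      have hij := hslack i j hj.symm
      subst hij
      rw [← hj]
      refine hs.lt_of_ne i _ fun h' => hkl ?_
      have h2 : m i = s k := by rw [← hj, h']
      exact absurd (hslack i k h2) hik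
    · exact hs.lt_slack i k _ (Ne.symm hik) h
  obtain ⟨x, hx⟩ := key a b hab hmab
  obtain ⟨y, hy⟩ := key b a hab.symm hmab.symm
  refine ⟨x, y, ?_, fun z => (hiff z).trans ⟨?_, ?_⟩⟩
  · rintro rfl
    obtain ⟨i, hi⟩ := hτ x
    by_cases h : i = a
    · exact absurd (hi _ (hmτ i)) (not_le.2 (hy.1 i (h ▸ hab)))
    · exact absurd (hi _ (hmτ i)) (not_le.2 (hx.1 i h))
  · rintro (h | h)
    · exact Or.inl (h.unique hr hx)
    · exact Or.inr (h.unique hr hy)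
  · rintro (rfl | rfl)
    · exact Or.inl hx
    · exact Or.inr hy

/-- The boundary facet lies in one room. Its minimizers are `s i` for `i ≠ i₀`, so the collision
involves `i₀`; at the other repeated index nothing exceeds all the required minimizers. -/
theorem IsSlack.card_extensions_of_slack [Fintype E] [Fintype I] [DecidableEq I] [Nontrivial I]
    {r : I → E → L} (hr : ∀ i, Function.Injective (r i)) {s : I → E} (hs : IsSlack r s)
    (hinj : Function.Injective s) {t : E} (hts : t ∉ Set.range s) (i₀ : I) :
    ∃ x, ∀ z, (z ∉ (Finset.univ.erase i₀).image s ∧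
      Dominant r (insert z ((Finset.univ.erase i₀).image s))) ↔ z = x := by
  set τ := (Finset.univ.erase i₀).image s with hτdef
  have hmem : ∀ i, i ≠ i₀ → s i ∈ τ := fun i hi =>
    Finset.mem_image_of_mem s (Finset.mem_erase.2 ⟨hi, Finset.mem_univ i⟩)
  have hτmem : ∀ y ∈ τ, ∃ i, i ≠ i₀ ∧ s i = y := fun y hy => by
    obtain ⟨i, hi, rfl⟩ := Finset.mem_image.1 hy
    exact ⟨i, (Finset.mem_erase.1 hi).1, rfl⟩
  have hcard : τ.card + 1 = Fintype.card I := by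
    rw [hτdef, Finset.card_image_of_injective _ hinj,
      Finset.card_erase_add_one (Finset.mem_univ _), Finset.card_univ]
  have hle : ∀ i y, r i (s i) ≤ r i y := fun i y => by
    by_cases h : y = s i
    · rw [h]
    · exact (hs.lt_of_ne i y h).le
  have hdom : Dominant r τ := by
    intro y
    by_cases hy : y ∈ Set.range s
    · obtain ⟨j, rfl⟩ := hy
      exact ⟨j, fun x _ => hle j x⟩
    · refine ⟨i₀, fun x hx => ?_⟩
      obtain ⟨i, hi, rfl⟩ := hτmem x hx
      exact (hs.lt_slack i₀ i y hi hy).le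
  obtain ⟨j₀, hj₀⟩ := exists_ne i₀
  obtain ⟨m, a, b, hmτ, hm, hab, hmab, hiff⟩ := hdom.exists_collision hr ⟨_, hmem j₀ hj₀⟩ hcard
  have hms : ∀ i, i ≠ i₀ → m i = s i := fun i hi =>
    hr i (le_antisymm (hm i _ (hmem i hi)) (hle i _))
  have hnone : ∀ b, b ≠ i₀ → m b = m i₀ → ∀ x, ¬ IsReplacement r m b x := by
    intro b hb hmb x hx
    have h1 := hx.1 i₀ hb.symm
    rw [← hmb, hms b hb] at h1
    by_cases hxs : x ∈ Set.range s
    · obtain ⟨j, rfl⟩ := hxs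
      have hj : j ≠ i₀ := by
        rintro rfl
        exact absurd h1 (not_lt.2 (hle _ _))
      have hjb : j ≠ b := by
        rintro rfl
        exact lt_irrefl _ h1
      have := hx.1 j hjb
      rw [hms j hj] at this
      exact lt_irrefl _ this
    · exact absurd h1 (not_lt.2 (hs.lt_slack i₀ b x hb hxs).le)
  have hsome : ∃ x, IsReplacement r m i₀ x :=
    exists_isReplacement (y := t) fun i hi => by
      rw [hms i hi]
      exact hs.lt_of_ne i t fun h => hts ⟨i, h.symm⟩
  obtain ⟨x, hx⟩ := hsome
  refine ⟨x, fun z => (hiff z).trans ?_⟩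
  have hcase : a = i₀ ∨ b = i₀ := by
    by_contra h
    push Not at h
    rw [hms a h.1, hms b h.2] at hmab
    exact hab (hinj hmab)
  constructor
  · rcases hcase with rfl | rfl
    · rintro (h | h)
      · exact h.unique hr hx
      · exact absurd h (hnone b hab.symm hmab.symm z)
    · rintro (h | h)
      · exact absurd h (hnone a hab hmab z)
      · exact h.unique hr hx
  · rintro rfl
    rcases hcase with rfl | rfl
    · exact Or.inl hx
    · exact Or.inr hx

/-- If removing `x₀` leaves each colour but `i₀` exactly once, then `x₀` repeats the colour of a
single `x₁`, and `x₀`, `x₁` are the only removable elements. -/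
theorem even_card_filter_image_erase [Fintype I] [DecidableEq I] (c : E → I) (i₀ : I)
    {S : Finset E} (hS : S.card = Fintype.card I) (hc : S.image c ≠ Finset.univ) :
    Even (S.filter fun x => (S.erase x).image c = Finset.univ.erase i₀).card := by
  rcases (S.filter fun x => (S.erase x).image c = Finset.univ.erase i₀).eq_empty_or_nonempty
    with h | ⟨x₀, hx₀⟩
  · rw [h]; exact Even.zero
  obtain ⟨hx₀S, hx₀⟩ := Finset.mem_filter.1 hx₀
  have hcx₀ : c x₀ ≠ i₀ := fun h => hc <| by
    rw [← Finset.insert_erase hx₀S, Finset.image_insert, hx₀, h,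
      Finset.insert_erase (Finset.mem_univ _)]
  have hinj : Set.InjOn c (S.erase x₀ : Finset E) := Finset.card_image_iff.1 <| by
    rw [hx₀, Finset.card_erase_of_mem (Finset.mem_univ _), Finset.card_erase_of_mem hx₀S, hS,
      Finset.card_univ]
  have : c x₀ ∈ (S.erase x₀).image c := by
    rw [hx₀]; exact Finset.mem_erase.2 ⟨hcx₀, Finset.mem_univ _⟩
  obtain ⟨x₁, hx₁, hcx₁⟩ := Finset.mem_image.1 this
  obtain ⟨hne, hx₁S⟩ := Finset.mem_erase.1 hx₁
  have hpair : (S.filter fun x => (S.erase x).image c = Finset.univ.erase i₀) = {x₀, x₁} := by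
    ext x
    simp only [Finset.mem_filter, Finset.mem_insert, Finset.mem_singleton]
    constructor
    · rintro ⟨hxS, hx⟩
      by_contra hx'
      push Not at hx'
      have h1 : c x ∈ (S.erase x).image c := by
        rw [hx, ← hx₀]
        exact Finset.mem_image_of_mem c (Finset.mem_erase.2 ⟨hx'.1, hxS⟩)
      obtain ⟨z, hz, hzx⟩ := Finset.mem_image.1 h1
      obtain ⟨hzne, hzS⟩ := Finset.mem_erase.1 hz
      have hxmem : x ∈ ((S.erase x₀ : Finset E) : Set E) := by simp [hx'.1, hxS]
      by_cases hz0 : z = x₀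
      · subst hz0
        exact hx'.2 (hinj hxmem (Finset.mem_coe.2 hx₁) (hzx.symm.trans hcx₁.symm))
      · exact hzne (hinj (Finset.mem_coe.2 (Finset.mem_erase.2 ⟨hz0, hzS⟩)) hxmem hzx)
    · rintro (rfl | rfl)
      · exact ⟨hx₀S, hx₀⟩
      · refine ⟨hx₁S, ?_⟩
        rw [← hx₀, ← Finset.insert_erase (Finset.mem_erase.2 ⟨hne, hx₁S⟩),
          ← Finset.insert_erase (Finset.mem_erase.2 ⟨hne.symm, hx₀S⟩), Finset.image_insert,
          Finset.image_insert, hcx₁, Finset.erase_right_comm]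
  rw [hpair, Finset.card_pair hne.symm]
  exact even_two

/-- **Scarf's combinatorial lemma**: for every colouring of a finite set with slack elements in
which the `i`-th slack element has colour `i`, there is a dominant set carrying each colour exactly
once. -/
theorem exists_dominant_image_eq_univ [Fintype E] [Fintype I] [DecidableEq I] [Nontrivial I]
    {r : I → E → L} (hr : ∀ i, Function.Injective (r i)) {s : I → E} (hs : IsSlack r s)
    {t : E} (hts : t ∉ Set.range s) (c : E → I) (hc : ∀ i, c (s i) = i) :
    ∃ S : Finset E, S.card = Fintype.card I ∧ Dominant r S ∧ S.image c = Finset.univ := by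
  classical
  by_contra hno
  push Not at hno
  have hinj : Function.Injective s := fun i j h => by rw [← hc i, ← hc j, h]
  obtain ⟨i₀⟩ : Nonempty I := inferInstance
  let R : Finset (Finset E) := Finset.univ.filter fun S => S.card = Fintype.card I ∧ Dominant r S
  -- Double count of (room, removed element) whose facet misses only colour `i₀`. By rooms the count
  -- is even if none has all colours; by facets it is odd, as `τ₀` contributes one and every other
  -- facet two.
  let P : Finset (Finset E × E) := Finset.univ.filter fun p =>
    p.1 ∈ R ∧ p.2 ∈ p.1 ∧ (p.1.erase p.2).image c = Finset.univ.erase i₀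
  have hPeven : Even P.card := by
    rw [Finset.card_eq_sum_card_fiberwise (f := Prod.fst) (t := R)
      (fun p hp => (Finset.mem_filter.1 hp).2.1)]
    refine Finset.even_sum _ fun S hS => ?_
    have hS' := (Finset.mem_filter.1 hS).2
    have := even_card_filter_image_erase c i₀ hS'.1 (hno S hS'.1 hS'.2)
    suffices h : (P.filter fun p => p.1 = S).card =
        (S.filter fun x => (S.erase x).image c = Finset.univ.erase i₀).card from h ▸ this
    refine Finset.card_bij' (fun p _ => p.2) (fun x _ => (S, x)) ?_ ?_ ?_ ?_
    · rintro ⟨S', x⟩ h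
      simp only [P, Finset.mem_filter] at h ⊢
      obtain ⟨⟨-, -, h1, h2⟩, rfl⟩ := h
      exact ⟨h1, h2⟩
    · intro x h
      simp only [P, Finset.mem_filter, Finset.mem_univ, true_and] at h ⊢
      exact ⟨⟨hS, h.1, h.2⟩, trivial⟩
    · rintro ⟨S', x⟩ h
      rw [← (Finset.mem_filter.1 h).2]
    · intro x h; rfl
  let τ₀ := (Finset.univ.erase i₀).image s
  let Q : Finset (Finset E) := Finset.univ.filter fun τ =>
    τ.card + 1 = Fintype.card I ∧ Dominant r τ ∧ τ.image c = Finset.univ.erase i₀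
  have hfib : ∀ τ ∈ Q, (P.filter fun p => p.1.erase p.2 = τ).card =
      (Finset.univ.filter fun x => x ∉ τ ∧ Dominant r (insert x τ)).card := by
    intro τ hτ
    obtain ⟨-, h1, h2, h3⟩ := Finset.mem_filter.1 hτ
    refine Finset.card_bij' (fun p _ => p.2) (fun x _ => (insert x τ, x)) ?_ ?_ ?_ ?_
    · rintro ⟨S, x⟩ h
      simp only [P, R, Finset.mem_filter, Finset.mem_univ, true_and] at h ⊢
      obtain ⟨⟨⟨h4, h5⟩, h6, h7⟩, rfl⟩ := h
      rw [Finset.insert_erase h6]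
      exact ⟨Finset.notMem_erase x S, h5⟩
    · intro x h
      simp only [P, R, Finset.mem_filter, Finset.mem_univ, true_and] at h ⊢
      rw [Finset.erase_insert h.1, Finset.card_insert_of_notMem h.1]
      exact ⟨⟨⟨h1, h.2⟩, Finset.mem_insert_self _ _, h3⟩, rfl⟩
    · rintro ⟨S, x⟩ h
      simp only [P, Finset.mem_filter, Finset.mem_univ, true_and] at h
      rw [← h.2, Finset.insert_erase h.1.2.1]
    · intro x h; rfl
  have hsum : P.card = ∑ τ ∈ Q, (P.filter fun p => p.1.erase p.2 = τ).card := by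
    refine Finset.card_eq_sum_card_fiberwise fun p hp => ?_
    obtain ⟨-, h1, h2, h3⟩ := Finset.mem_filter.1 hp
    obtain ⟨-, h4, h5⟩ := Finset.mem_filter.1 h1
    refine Finset.mem_coe.2 (Finset.mem_filter.2 ⟨Finset.mem_univ _, ?_,
      h5.mono (Finset.erase_subset _ _), h3⟩)
    rw [Finset.card_erase_add_one h2, h4]
  obtain ⟨x₀, hx₀⟩ := hs.card_extensions_of_slack hr hinj hts i₀
  have hτ₀ : τ₀ ∈ Q := by
    refine Finset.mem_filter.2 ⟨Finset.mem_univ _, ?_,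
      ((hx₀ x₀).2 rfl).2.mono (Finset.subset_insert _ _), ?_⟩
    · rw [Finset.card_image_of_injective _ hinj,
        Finset.card_erase_add_one (Finset.mem_univ _), Finset.card_univ]
    · rw [Finset.image_image]
      have : c ∘ s = id := funext hc
      rw [this, Finset.image_id]
  rw [hsum, ← Finset.add_sum_erase _ _ hτ₀, hfib _ hτ₀] at hPeven
  have hone : (Finset.univ.filter fun x => x ∉ τ₀ ∧ Dominant r (insert x τ₀)).card = 1 :=
    Finset.card_eq_one.2 ⟨x₀, by
      ext z
      rw [Finset.mem_filter, Finset.mem_singleton, ← hx₀ z]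
      exact and_iff_right (Finset.mem_univ z)⟩
  have hrest : Even (∑ τ ∈ Q.erase τ₀, (P.filter fun p => p.1.erase p.2 = τ).card) := by
    refine Finset.even_sum _ fun τ hτ => ?_
    obtain ⟨hne, hτQ⟩ := Finset.mem_erase.1 hτ
    rw [hfib τ hτQ]
    obtain ⟨-, h1, h2, h3⟩ := Finset.mem_filter.1 hτQ
    -- An all-slack facet is determined by its colours, so it would be `τ₀`.
    have : ∃ t ∈ τ, t ∉ Set.range s := by
      by_contra hall
      push Not at hall
      refine hne (Finset.eq_of_subset_of_card_le (fun y hy => ?_) ?_)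
      · obtain ⟨i, rfl⟩ := hall y hy
        refine Finset.mem_image_of_mem s ?_
        rw [← h3]
        have := Finset.mem_image_of_mem c hy
        rwa [hc] at this
      · rw [Finset.card_image_of_injective _ hinj,
          Finset.card_erase_of_mem (Finset.mem_univ _), Finset.card_univ]
        omega
    obtain ⟨t', ht', hts'⟩ := this
    obtain ⟨x, y, hxy, h⟩ := hs.card_extensions_of_mem hr h2 h1 ht' hts'
    have : (Finset.univ.filter fun x => x ∉ τ ∧ Dominant r (insert x τ)) = {x, y} := by
      ext z; simpa using h z
    rw [this, Finset.card_pair hxy]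
    exact even_two
  rw [hone] at hPeven
  exact absurd hPeven (by rw [Nat.even_add]; simp [hrest])

end Scarf

/-! ### Scarf's lemma on an integer grid of the simplex. -/

namespace Scarf

/-- Scarf's lemma is applied to the grid points of sum `m` ordered by coordinates, with one slack
per coordinate. The lower corner `p` of the dominant set carrying all colours has sum nearly `m`, so
the grid points in that set are all close to `p`. -/
theorem exists_grid_point {I : Type*} [Fintype I] [DecidableEq I] [Nontrivial I] (m : ℕ)
    (c : (I → ℕ) → I) :
    ∃ p : I → ℕ, ∑ i, p i ≤ m ∧ m ≤ ∑ i, p i + Fintype.card I ∧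
      ∀ i, p i ≠ 0 → ∃ x : I → ℕ, ∑ j, x j = m ∧ c x = i ∧
        ∀ j, p j ≤ x j ∧ x j ≤ p j + Fintype.card I := by
  classical
  let T := {a : I → ℕ // a ∈ (Finset.univ : Finset I).piAntidiag m}
  have hT : ∀ a : T, ∑ j, a.1 j = m := fun a => (Finset.mem_piAntidiag.1 a.2).1
  have hmk : ∀ a : I → ℕ, ∑ j, a j = m → a ∈ (Finset.univ : Finset I).piAntidiag m :=
    fun a ha => Finset.mem_piAntidiag.2 ⟨ha, fun i _ => Finset.mem_univ i⟩
  have hTle : ∀ (a : T) j, a.1 j ≤ m := fun a j =>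
    (Finset.single_le_sum (fun _ _ => Nat.zero_le _) (Finset.mem_univ j)).trans_eq (hT a)
  obtain ⟨i₀⟩ : Nonempty I := inferInstance
  let e := Fintype.equivFin (T ⊕ I)
  -- Grid coordinates are shifted by one, to lie in `[1, m + 1]`, strictly between the slack values
  -- `0` and `m + 2`; ties are broken by `e`.
  let v : I → T ⊕ I → ℕ := fun i =>
    Sum.elim (fun a => a.1 i + 1) (fun j => if j = i then 0 else m + 2)
  let r : I → T ⊕ I → ℕ ×ₗ ℕ := fun i x => toLex (v i x, (e x : ℕ))
  have hr : ∀ i, Function.Injective (r i) := fun i x y h => by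
    have h2 : (e x : ℕ) = e y := congrArg (fun z => (ofLex z).2) h
    exact e.injective (Fin.ext h2)
  have hlt : ∀ i x y, v i x < v i y → r i x < r i y := fun i x y h =>
    Prod.Lex.toLex_lt_toLex.2 (Or.inl h)
  have hle : ∀ i x y, r i x ≤ r i y → v i x ≤ v i y := fun i x y h => by
    by_contra h'
    exact absurd h (not_le.2 (hlt i y x (not_le.1 h')))
  have hs : IsSlack r (Sum.inr : I → T ⊕ I) := by
    refine ⟨fun i y hy => hlt _ _ _ ?_, fun i j y hji hy => hlt _ _ _ ?_⟩
    · rcases y with a | j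
      · simp [v]
      · have : j ≠ i := fun h => hy (by rw [h])
        simp [v, this]
    · rcases y with a | k
      · have := hTle a i
        simp only [v, Sum.elim_inl, Sum.elim_inr, if_neg hji]
        omega
      · exact absurd ⟨k, rfl⟩ hy
  let t₀ : T := ⟨fun j => if j = i₀ then m else 0, hmk _ (by simp)⟩
  obtain ⟨S, -, hdom, himg⟩ := exists_dominant_image_eq_univ hr hs (t := Sum.inl t₀) (by simp)
    (Sum.elim (fun a => c a.1) id) (fun i => rfl)
  let C : Finset I := Finset.univ.filter fun i => Sum.inr i ∉ S
  have hcol : ∀ i ∈ C, ∃ a : T, Sum.inl a ∈ S ∧ c a.1 = i := by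
    intro i hi
    have hi' := Finset.mem_univ i
    rw [← himg] at hi'
    obtain ⟨x, hxS, hx⟩ := Finset.mem_image.1 hi'
    rcases x with a | j
    · exact ⟨a, hxS, hx⟩
    · have : j = i := hx
      exact absurd (this ▸ hxS) (Finset.mem_filter.1 hi).2
  have hdomT : ∀ y : T, ∃ i ∈ C, ∀ a : T, Sum.inl a ∈ S → y.1 i ≤ a.1 i := by
    intro y
    obtain ⟨i, hi⟩ := hdom (Sum.inl y)
    refine ⟨i, Finset.mem_filter.2 ⟨Finset.mem_univ _, fun h => ?_⟩, fun a ha => ?_⟩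
    · have := hle _ _ _ (hi _ h)
      simp [v] at this
    · have := hle _ _ _ (hi _ ha)
      simpa [v] using this
  obtain ⟨k₀, hk₀, -⟩ := hdomT t₀
  obtain ⟨a₀, ha₀, -⟩ := hcol k₀ hk₀
  have hST : (Finset.univ.filter fun a : T => Sum.inl a ∈ S).Nonempty :=
    ⟨a₀, Finset.mem_filter.2 ⟨Finset.mem_univ _, ha₀⟩⟩
  choose μ hμS hμ using fun i : I =>
    (Finset.univ.filter fun a : T => Sum.inl a ∈ S).exists_min_image (fun a => a.1 i) hST
  -- Outside `C` colour `i` may be carried only by a slack element; the value `0` exempts such `i`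
  -- from the conclusion.
  let p : I → ℕ := fun i => if i ∈ C then (μ i).1 i else 0
  have hpx : ∀ a : T, Sum.inl a ∈ S → ∀ j, p j ≤ a.1 j := by
    intro a ha j
    by_cases hj : j ∈ C
    · simp only [p, if_pos hj]
      exact hμ j a (Finset.mem_filter.2 ⟨Finset.mem_univ _, ha⟩)
    · simp [p, hj]
  have hpm : ∑ i, p i ≤ m := (Finset.sum_le_sum fun i _ => hpx a₀ ha₀ i).trans_eq (hT a₀)
  have hmp : m ≤ ∑ i, p i + Fintype.card I := by
    by_contra hlt'
    push Not at hlt'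
    have hsum : ∑ i, (p i + 1) ≤ m := by
      rw [Finset.sum_add_distrib, Finset.sum_const, Finset.card_univ, smul_eq_mul, mul_one]
      exact hlt'.le
    -- A grid point exceeding `p` in every coordinate, the remaining mass being put on `i₀`; it
    -- contradicts dominance.
    let y : T := ⟨fun i => p i + 1 + if i = i₀ then m - ∑ i, (p i + 1) else 0, hmk _ (by
      rw [Finset.sum_add_distrib, Finset.sum_ite_eq' Finset.univ i₀, if_pos (Finset.mem_univ _)]
      omega)⟩
    obtain ⟨i, hiC, hi⟩ := hdomT y
    have h1 := hi (μ i) (Finset.mem_filter.1 (hμS i)).2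
    have h2 : p i = (μ i).1 i := if_pos hiC
    have h3 : p i + 1 ≤ y.1 i := Nat.le_add_right _ _
    omega
  refine ⟨p, hpm, hmp, fun i hi => ?_⟩
  have hiC : i ∈ C := by
    by_contra h
    exact hi (if_neg h)
  obtain ⟨a, haS, hai⟩ := hcol i hiC
  refine ⟨a.1, hT a, hai, fun j => ⟨hpx a haS j, ?_⟩⟩
  have h1 := Finset.sum_erase_add Finset.univ a.1 (Finset.mem_univ j)
  have h2 := Finset.sum_erase_add Finset.univ p (Finset.mem_univ j)
  have h3 : ∑ k ∈ Finset.univ.erase j, p k ≤ ∑ k ∈ Finset.univ.erase j, a.1 k :=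
    Finset.sum_le_sum fun k _ => hpx a haS k
  have h4 := hT a
  omega

end Scarf

/-! ### From the grid to KKM. -/

open Filter Topology in
/-- If finitely many closed sets cover the standard simplex, some point of the simplex lies in
every set whose index belongs to the support of the point. -/
theorem exists_mem_stdSimplex_forall_mem_of_cover {I : Type*} [Fintype I] [Nonempty I]
    {A : I → Set (I → ℝ)} (hA : ∀ i, IsClosed (A i))
    (hcov : ∀ x ∈ stdSimplex ℝ I, ∃ i, x ∈ A i) :
    ∃ q ∈ stdSimplex ℝ I, ∀ i, 0 < q i → q ∈ A i := by
  classical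
  rcases subsingleton_or_nontrivial I with hI | hI
  · obtain ⟨i₀⟩ : Nonempty I := inferInstance
    have hmem := single_mem_stdSimplex ℝ i₀
    obtain ⟨i, hi⟩ := hcov _ hmem
    exact ⟨_, hmem, fun j _ => Subsingleton.elim i j ▸ hi⟩
  let N : ℝ := Fintype.card I
  let sc : ℕ → (I → ℕ) → I → ℝ := fun k x i => (x i : ℝ) / (k + 1)
  have hkpos : ∀ k : ℕ, (0 : ℝ) < k + 1 := fun k => by positivity
  have hsum : ∀ k x, ∑ i, sc k x i = ((∑ i, x i : ℕ) : ℝ) / (k + 1) := fun k x => by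
    simp only [sc]
    rw [← Finset.sum_div, Nat.cast_sum]
  have hsimp : ∀ k x, ∑ i, x i = k + 1 → sc k x ∈ stdSimplex ℝ I := fun k x hx => by
    refine ⟨fun i => div_nonneg (Nat.cast_nonneg _) (hkpos k).le, ?_⟩
    rw [hsum, hx, Nat.cast_add, Nat.cast_one, div_self (hkpos k).ne']
  have hcol : ∀ (k : ℕ) (x : I → ℕ), ∃ i, ∑ j, x j = k + 1 → sc k x ∈ A i := fun k x => by
    by_cases h : ∑ j, x j = k + 1
    · obtain ⟨i, hi⟩ := hcov _ (hsimp k x h)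
      exact ⟨i, fun _ => hi⟩
    · exact ⟨Classical.arbitrary I, fun h' => absurd h' h⟩
  choose c hc using hcol
  choose p hp1 hp2 hp3 using fun k => Scarf.exists_grid_point (k + 1) (c k)
  have hbox : ∀ k, sc k (p k) ∈ Set.Icc (0 : I → ℝ) 1 := fun k => by
    refine ⟨fun i => div_nonneg (Nat.cast_nonneg _) (hkpos k).le, fun i => ?_⟩
    have h1 : p k i ≤ k + 1 :=
      (Finset.single_le_sum (fun _ _ => Nat.zero_le _) (Finset.mem_univ i)).trans (hp1 k)
    exact (div_le_one (hkpos k)).2 (by exact_mod_cast h1)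
  -- Compactness of the cube is used because the scaled corners need not lie in the simplex; their
  -- sums miss `1` by at most `N / (k + 1)`, so the limit does lie there.
  obtain ⟨q, -, φ, hφ, hq⟩ := isCompact_Icc.tendsto_subseq hbox
  have hN : Tendsto (fun k : ℕ => N / ((φ k : ℝ) + 1)) atTop (𝓝 0) := by
    have := (tendsto_one_div_add_atTop_nhds_zero_nat (𝕜 := ℝ)).const_mul N
    simp only [mul_one_div, mul_zero] at this
    exact this.comp hφ.tendsto_atTop
  have hqi : ∀ i, Tendsto (fun k => sc (φ k) (p (φ k)) i) atTop (𝓝 (q i)) := fun i =>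
    (tendsto_pi_nhds.1 hq) i
  have hq0 : ∀ i, 0 ≤ q i := fun i => ge_of_tendsto' (hqi i) fun k => (hbox (φ k)).1 i
  have hqsum : ∑ i, q i = 1 := by
    have h1 : Tendsto (fun k => ∑ i, sc (φ k) (p (φ k)) i) atTop (𝓝 (∑ i, q i)) :=
      tendsto_finsetSum _ fun i _ => hqi i
    refine le_antisymm (le_of_tendsto' h1 fun k => ?_) ?_
    · rw [hsum]
      exact (div_le_one (hkpos _)).2 (by exact_mod_cast hp1 (φ k))
    · have h2 := h1.add hN
      rw [add_zero] at h2
      refine ge_of_tendsto' h2 fun k => ?_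
      rw [hsum, ← add_div, le_div_iff₀ (hkpos _), one_mul]
      have := hp2 (φ k)
      simp only [N]
      exact_mod_cast this
  refine ⟨q, ⟨hq0, hqsum⟩, fun i hi => ?_⟩
  rw [← (hA i).closure_eq, Metric.mem_closure_iff]
  intro ε hε
  obtain ⟨k, h1, h2, h3⟩ := (((hqi i).eventually (lt_mem_nhds hi)).and
    ((hN.eventually (gt_mem_nhds (half_pos hε))).and
      (hq.eventually (Metric.ball_mem_nhds q (half_pos hε))))).exists
  have hne : p (φ k) i ≠ 0 := fun h => by
    simp [sc, h] at h1
  obtain ⟨x, hx1, hx2, hx3⟩ := hp3 (φ k) i hne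
  refine ⟨sc (φ k) x, hx2 ▸ hc (φ k) x hx1, ?_⟩
  have hd : dist (sc (φ k) (p (φ k))) (sc (φ k) x) ≤ N / ((φ k : ℝ) + 1) := by
    refine (dist_pi_le_iff (by positivity)).2 fun j => ?_
    simp only [sc]
    rw [Real.dist_eq, ← sub_div, abs_div, abs_of_pos (hkpos _)]
    refine div_le_div_of_nonneg_right ?_ (hkpos _).le
    have h5 : (p (φ k) j : ℝ) ≤ x j := by exact_mod_cast (hx3 j).1
    have h6 : (x j : ℝ) ≤ p (φ k) j + N := by
      simp only [N]
      exact_mod_cast (hx3 j).2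
    rw [abs_le]
    constructor <;> linarith [show 0 ≤ N from Nat.cast_nonneg _]
  calc dist q (sc (φ k) x)
      ≤ dist q (sc (φ k) (p (φ k))) + dist (sc (φ k) (p (φ k))) (sc (φ k) x) :=
        dist_triangle _ _ _
    _ < ε / 2 + ε / 2 := add_lt_add_of_lt_of_le (by rw [dist_comm]; exact h3) (hd.trans h2.le)
    _ = ε := add_halves ε

/-- **Knaster–Kuratowski–Mazurkiewicz theorem** on the standard simplex. -/
theorem exists_mem_stdSimplex_forall_mem_of_kkm {I : Type*} [Fintype I] [Nonempty I]
    {A : I → Set (I → ℝ)} (hA : ∀ i, IsClosed (A i))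
    (hkkm : ∀ x ∈ stdSimplex ℝ I, ∃ i, 0 < x i ∧ x ∈ A i) :
    ∃ x ∈ stdSimplex ℝ I, ∀ i, x ∈ A i := by
  classical
  -- At the `i`-th vertex only coordinate `i` is positive. Nonemptiness matters because `infDist` to
  -- the empty set is `0`.
  have hne : ∀ i, (A i).Nonempty := fun i => by
    obtain ⟨j, hj, hjA⟩ := hkkm _ (single_mem_stdSimplex ℝ i)
    have : j = i := by
      by_contra h
      simp [h] at hj
    exact ⟨_, this ▸ hjA⟩
  let G : (I → ℝ) → I → ℝ := fun x i => Metric.infDist x (A i)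
  have hG : ∀ i, Continuous fun x => G x i := fun i => Metric.continuous_infDist_pt (A i)
  -- These sets cover: if all inequalities failed, summing them would give `∑ G < ∑ G`. At the point
  -- obtained, the KKM index `i` has `x i > 0` and `G x i = 0`, which forces `∑ j, G x j = 0`.
  obtain ⟨x, hx, hxB⟩ := exists_mem_stdSimplex_forall_mem_of_cover
    (A := fun i => {x | x i * ∑ j, G x j ≤ G x i})
    (fun i => isClosed_le ((continuous_apply i).mul (continuous_finsetSum _ fun j _ => hG j)) (hG i))
    (fun x hx => by
      by_contra h
      have := Finset.sum_lt_sum_of_nonempty Finset.univ_nonempty fun i _ =>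
        (not_le.1 fun h' => h ⟨i, h'⟩ : G x i < x i * ∑ j, G x j)
      rw [← Finset.sum_mul, hx.2, one_mul] at this
      exact lt_irrefl _ this)
  refine ⟨x, hx, ?_⟩
  by_contra hnot
  push Not at hnot
  obtain ⟨k, hk⟩ := hnot
  have hpos : 0 < ∑ j, G x j :=
    Finset.sum_pos' (fun j _ => Metric.infDist_nonneg)
      ⟨k, Finset.mem_univ k, ((hA k).notMem_iff_infDist_pos (hne k)).1 hk⟩
  obtain ⟨i, hi, hiA⟩ := hkkm x hx
  have h1 : x i * ∑ j, G x j ≤ G x i := hxB i hi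
  have h2 : G x i = 0 := Metric.infDist_zero_of_mem hiA
  exact absurd (h2 ▸ h1) (not_le.2 (mul_pos hi hpos))

/-! ### Self segment-density and the minimax inequality. -/

/-- If the segments between points of `S` lie in the closure of `S`, then that closure is convex. -/
theorem convex_closure_of_segment_subset {X : Type*} [AddCommGroup X] [Module ℝ X]
    [TopologicalSpace X] [IsTopologicalAddGroup X] [ContinuousSMul ℝ X] {S : Set X}
    (hS : ∀ x ∈ S, ∀ y ∈ S, segment ℝ x y ⊆ closure S) : Convex ℝ (closure S) := by
  intro x hx y hy a b ha hb hab
  rw [← closure_closure]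
  refine map_mem_closure₂ (f := fun u v : X => a • u + b • v) (by fun_prop) hx hy ?_
  exact fun u hu v hv => hS u hu v hv ⟨a, b, ha, hb, hab, rfl⟩

/-- A self segment-dense set is dense in every polytope with vertices in the set. -/
theorem IsSelfSegmentDense.convexHull_subset_closure {X : Type*} [AddCommGroup X] [Module ℝ X]
    [TopologicalSpace X] [IsTopologicalAddGroup X] [ContinuousSMul ℝ X] {U V : Set X}
    (h : IsSelfSegmentDense U V) {s : Set X} (hs : s ⊆ U) :
    convexHull ℝ s ⊆ closure (convexHull ℝ s ∩ U) := by
  refine convexHull_min (fun x hx => subset_closure ⟨subset_convexHull ℝ s hx, hs hx⟩)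
    (convex_closure_of_segment_subset fun x hx y hy => ?_)
  refine (h.2.2 x hx.2 y hy.2).trans (closure_mono ?_)
  exact Set.inter_subset_inter_left U ((convex_convexHull ℝ s).segment_subset hx.1 hy.1)

theorem IsConcaveOnSubset.sum_le {X : Type*} [AddCommGroup X] [Module ℝ X] {D : Set X} {f : X → ℝ}
    (hf : IsConcaveOnSubset D f) {v : Finset X} (hv : ↑v ⊆ D) {w : X → ℝ}
    (hw : ∀ y ∈ v, 0 ≤ w y) (hw1 : ∑ y ∈ v, w y = 1) (hD : ∑ y ∈ v, w y • y ∈ D) :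
    ∑ y ∈ v, w y * f y ≤ f (∑ y ∈ v, w y • y) := by
  have hsum : ∀ {M : Type _} [AddCommMonoid M] (g : X → M),
      ∑ i, g (v.equivFin.symm i) = ∑ y ∈ v, g y := fun g => by
    rw [v.equivFin.symm.sum_comp fun y : v => g y, Finset.sum_coe_sort]
  have hsumX : ∑ i, w (v.equivFin.symm i) • (v.equivFin.symm i : X) = ∑ y ∈ v, w y • y := by
    rw [v.equivFin.symm.sum_comp fun y : v => w y • (y : X), Finset.sum_coe_sort v fun y => w y • y]
  have := hf v.card (fun i => v.equivFin.symm i) (fun i => w (v.equivFin.symm i))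
    (fun i => hv (v.equivFin.symm i).2) (fun i => hw _ (v.equivFin.symm i).2)
    ((hsum w).trans hw1) (by rw [hsumX]; exact hD)
  rwa [hsumX, hsum fun y => w y * f y] at this

theorem LowerSemicontinuousOn.isClosed_sublevel {X : Type*} [TopologicalSpace X] {K : Set X}
    (hK : IsClosed K) {f : X → ℝ} (hf : LowerSemicontinuousOn f K) (c : ℝ) :
    IsClosed {x | x ∈ K ∧ f x ≤ c} := by
  obtain ⟨C, hC, h⟩ := lowerSemicontinuousOn_iff_preimage_Iic.1 hf c
  have : {x | x ∈ K ∧ f x ≤ c} = K ∩ C := h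
  exact this ▸ hK.inter hC

section
variable {X : Type*} [AddCommGroup X] [Module ℝ X] [TopologicalSpace X]
  [IsTopologicalAddGroup X] [ContinuousSMul ℝ X] {K D : Set X} {φ : X → X → ℝ}

/-- The sublevel sets `{x ∈ K | φ x y ≤ 0}`, for finitely many `y` in `D`, have a common point. -/
theorem IsSelfSegmentDense.exists_forall_nonpos_of_fintype
    (hKclosed : IsClosed K) (hD : IsSelfSegmentDense D K)
    (hlsc : ∀ y ∈ D, LowerSemicontinuousOn (fun x => φ x y) K)
    (hconc : ∀ x ∈ D, IsConcaveOnSubset D (fun y => φ x y))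
    (hdiag : ∀ x ∈ D, φ x x ≤ 0) {I : Type*} [Fintype I] [Nonempty I] (y : I → X)
    (hy : ∀ i, y i ∈ D) : ∃ x ∈ K, ∀ i, φ x (y i) ≤ 0 := by
  classical
  let F : I → Set X := fun i => {x | x ∈ K ∧ φ x (y i) ≤ 0}
  have hF : ∀ i, IsClosed (F i) := fun i => (hlsc _ (hy i)).isClosed_sublevel hKclosed 0
  let g : (I → ℝ) → X := fun l => ∑ i, l i • y i
  have hg : Continuous g := by fun_prop
  obtain ⟨l, hl, hlF⟩ := exists_mem_stdSimplex_forall_mem_of_kkm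
    (A := fun i => g ⁻¹' F i) (fun i => (hF i).preimage hg) (fun l hl => by
      let s : Finset I := Finset.univ.filter fun i => 0 < l i
      let v : Finset X := s.image y
      have hvD : (v : Set X) ⊆ D := fun z hz => by
        obtain ⟨i, -, rfl⟩ := Finset.mem_image.1 (Finset.mem_coe.1 hz)
        exact hy i
      have hzero : ∀ i ∉ s, l i = 0 := fun i hi =>
        le_antisymm (not_lt.1 fun h => hi (Finset.mem_filter.2 ⟨Finset.mem_univ _, h⟩)) (hl.1 i)
      have hmem : g l ∈ convexHull ℝ (v : Set X) := by
        have h1 : ∑ i ∈ s, l i = 1 := by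
          rw [← hl.2]
          exact Finset.sum_subset (Finset.subset_univ s) fun i _ hi => hzero i hi
        have h2 : ∑ i ∈ s, l i • y i = g l :=
          Finset.sum_subset (Finset.subset_univ s) fun i _ hi => by rw [hzero i hi, zero_smul]
        rw [← h2]
        exact (convex_convexHull ℝ _).sum_mem (fun i _ => hl.1 i) h1
          fun i hi => subset_convexHull ℝ _ (Finset.mem_coe.2 (Finset.mem_image_of_mem y hi))
      -- For `z` outside the union, concavity would give `0 < ∑ w u * φ z u ≤ φ z z ≤ 0`; it applies
      -- because the combination `z` itself lies in `D`.
      have hcover : convexHull ℝ (v : Set X) ∩ D ⊆ ⋃ i ∈ s, F i := by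
        rintro z ⟨hz, hzD⟩
        obtain ⟨w, hw0, hw1, hwz⟩ := Finset.mem_convexHull'.1 hz
        by_contra hnot
        simp only [Set.mem_iUnion, not_exists] at hnot
        have hpos : ∀ u ∈ v, 0 < φ z u := fun u hu => by
          obtain ⟨i, hi, rfl⟩ := Finset.mem_image.1 hu
          exact not_le.1 fun h => hnot i hi ⟨hD.1 hzD, h⟩
        obtain ⟨u, hu, hwu⟩ : ∃ u ∈ v, 0 < w u := by
          by_contra h
          push Not at h
          exact absurd (hw1 ▸ Finset.sum_nonpos h) (not_le.2 one_pos)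
        have h1 := (hconc z hzD).sum_le hvD hw0 hw1 (by rw [hwz]; exact hzD)
        rw [hwz] at h1
        have h2 : 0 < ∑ u ∈ v, w u * φ z u :=
          Finset.sum_pos' (fun u hu => mul_nonneg (hw0 u hu) (hpos u hu).le)
            ⟨u, hu, mul_pos hwu (hpos u hu)⟩
        exact absurd (h1.trans (hdiag z hzD)) (not_le.2 h2)
      have hcl : IsClosed (⋃ i ∈ s, F i) := s.finite_toSet.isClosed_biUnion fun i _ => hF i
      -- The point `g l` need not belong to `D`; density of `D` in the polytope carries the cover
      -- over to it.
      have := closure_minimal hcover hcl (hD.convexHull_subset_closure hvD hmem)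
      simp only [Set.mem_iUnion] at this
      obtain ⟨i, hi, hiF⟩ := this
      exact ⟨i, (Finset.mem_filter.1 hi).2, hiF⟩)
  obtain ⟨i₀⟩ : Nonempty I := inferInstance
  exact ⟨g l, (hlF i₀).1, fun i => (hlF i).2⟩

/-- Ky Fan's minimax inequality on a self segment-dense subset. -/
theorem IsSelfSegmentDense.exists_forall_mem_nonpos [T2Space X] (hKne : K.Nonempty)
    (hKcomp : IsCompact K) (hD : IsSelfSegmentDense D K)
    (hlsc : ∀ y ∈ D, LowerSemicontinuousOn (fun x => φ x y) K)
    (hconc : ∀ x ∈ D, IsConcaveOnSubset D (fun y => φ x y))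
    (hdiag : ∀ x ∈ D, φ x x ≤ 0) : ∃ x ∈ K, ∀ y ∈ D, φ x y ≤ 0 := by
  obtain ⟨x, hxK, hx⟩ := hKcomp.inter_iInter_nonempty
    (fun y : D => {x | x ∈ K ∧ φ x y ≤ 0})
    (fun y => (hlsc y y.2).isClosed_sublevel hKcomp.isClosed 0) (fun u => by
      -- KKM needs a nonempty index type, so the empty subfamily is settled by `K` being nonempty.
      rcases u.eq_empty_or_nonempty with rfl | hu
      · simpa using hKne
      · have : Nonempty u := hu.to_subtype
        obtain ⟨x, hxK, hx⟩ := hD.exists_forall_nonpos_of_fintype hKcomp.isClosed hlsc hconc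
          hdiag (fun i : u => ((i : D) : X)) (fun i => i.1.2)
        exact ⟨x, hxK, Set.mem_iInter₂.2 fun y hy => ⟨hxK, hx ⟨y, hy⟩⟩⟩)
  exact ⟨x, hxK, fun y hy => (Set.mem_iInter.1 hx ⟨y, hy⟩).2⟩

end

theorem theorem3p7 {X : Type*} [AddCommGroup X] [Module ℝ X] [TopologicalSpace X]
    [IsTopologicalAddGroup X] [ContinuousSMul ℝ X] [LocallyConvexSpace ℝ X] [T2Space X]
    (K D : Set X) (hKne : K.Nonempty) (hKconv : Convex ℝ K) (hKcomp : IsCompact K)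
    (hD : IsSelfSegmentDense D K)
    (φ : X → X → ℝ)
    (h_i : ∀ y ∈ D, LowerSemicontinuousOn (fun x => φ x y) K)
    (h_ii : ∀ x ∈ K, ∀ y ∈ K \ D, LowerSemicontinuousWithinAt (fun z => φ x z) K y)
    (h_iii : ∀ x ∈ D, IsConcaveOnSubset D (fun y => φ x y))
    (h_iv : ∀ x ∈ D, φ x x ≤ 0) :
    ∃ x₀ ∈ K, ∀ y ∈ K, φ x₀ y ≤ 0 := by
  obtain ⟨x, hxK, hx⟩ := hD.exists_forall_mem_nonpos hKne hKcomp h_i h_iii h_iv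
  refine ⟨x, hxK, fun y hy => ?_⟩
  by_cases hyD : y ∈ D
  · exact hx y hyD
  by_contra hpos
  -- Positivity of `φ x y` would persist near `y` in `K`, hence at some point of the dense set `D`.
  have hev := (h_ii x hxK y ⟨hy, hyD⟩ 0 (not_le.1 hpos)).filter_mono (nhdsWithin_mono y hD.1)
  have : (nhdsWithin y D).NeBot := mem_closure_iff_nhdsWithin_neBot.1 (hD.2.1 hy)
  obtain ⟨z, hz, hzD⟩ := (hev.and self_mem_nhdsWithin).exists
  exact absurd (hx z hzD) (not_le.2 hz)
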